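/- Let $K \ge 3$ be an odd integer, and let $$D^{(K)} = \{x = (x_0,\ldots,x_{K-1}) \in [0,1]^K : x_0 + \cdots + x_{K-1} = 1\}$$ be the standard $(K-1)$-simplex. For $x \in D^{(K)}$ put $$f_3^{(K)}(x) = \sum_{\substack{0 \le i_0 < i_1 < i_2 < K\\ i_1 - i_0,\ i_2 - i_1 \text{ odd}}} x_{i_0} x_{i_1} x_{i_2}, \qquad f_5^{(K)}(x) = \sum_{\substack{0 \le i_0 < i_1 < i_2 < i_3 < i_4 < K\\ i_1 - i_0,\ i_2 - i_1,\ i_3 - i_2,\ i_4 - i_3 \text{ odd}}} x_{i_0} x_{i_1} x_{i_2} x_{i_3} x_{i_4},$$ and $f^{(K)}(x) = f_3^{(K)}(x) - 24\, f_5^{(K)}(x)$. Then $f^{(K)}$ attains a maximum on $D^{(K)}$, and $$\max_{x \in D^{(K)}} f^{(K)}(x) = \frac{1}{27}.$$ -/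

import Mathlib

namespace Herman

/-- The index triples `(i₀, i₁, i₂)` with `0 ≤ i₀ < i₁ < i₂ < K` and `i₁ - i₀`, `i₂ - i₁` odd. -/
def triples (K : ℕ) : Finset (Fin K × Fin K × Fin K) :=
  Finset.univ.filter fun (i₀, i₁, i₂) =>
    (i₀ < i₁ ∧ i₁ < i₂) ∧
      (Odd ((i₁ : ℕ) - (i₀ : ℕ)) ∧ Odd ((i₂ : ℕ) - (i₁ : ℕ)))

/-- The index quintuples `(i₀, i₁, i₂, i₃, i₄)` with `0 ≤ i₀ < i₁ < i₂ < i₃ < i₄ < K` and all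
four differences of consecutive indices odd. -/
def quintuples (K : ℕ) : Finset (Fin K × Fin K × Fin K × Fin K × Fin K) :=
  Finset.univ.filter fun (i₀, i₁, i₂, i₃, i₄) =>
    (i₀ < i₁ ∧ i₁ < i₂ ∧ i₂ < i₃ ∧ i₃ < i₄) ∧
      (Odd ((i₁ : ℕ) - (i₀ : ℕ)) ∧ Odd ((i₂ : ℕ) - (i₁ : ℕ)) ∧
        Odd ((i₃ : ℕ) - (i₂ : ℕ)) ∧ Odd ((i₄ : ℕ) - (i₃ : ℕ)))

/-- The cubic polynomial `f₃` in `K` variables. -/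
def f₃ (K : ℕ) (x : Fin K → ℝ) : ℝ :=
  ∑ i ∈ triples K, x i.1 * x i.2.1 * x i.2.2

/-- The quintic polynomial `f₅` in `K` variables. -/
def f₅ (K : ℕ) (x : Fin K → ℝ) : ℝ :=
  ∑ i ∈ quintuples K, x i.1 * x i.2.1 * x i.2.2.1 * x i.2.2.2.1 * x i.2.2.2.2

/-- The polynomial `f = f₃ - 24 f₅` in `K` variables. -/
def f (K : ℕ) (x : Fin K → ℝ) : ℝ :=
  f₃ K x - 24 * f₅ K x

end Herman

namespace Herman

open Polynomial

/-! For positive weights and odd `K`, the trace of the product of the matrices `!![x i * t, 1; 1,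
0]` is `t * H(t²)` with `H = 1 + f₃ X + f₅ X² + ⋯` (`coeff_discr_odd`). An energy argument shows
that an eigenvalue of modulus one forces `t` to be imaginary (`re_eq_zero_of_transfer_mulVec`).
Eigenvalue `1` then makes the zeros of `H` real and nonpositive; eigenvalue `I` makes every solution
of `z H(-z²) = 2` real.

Put `D(z) = z H(-z²)`. Since `D - 2` is real-rooted, `D` has no local maximum below `2`
(`not_negative_local_max`). If `f₃ - 24 f₅ > 1/27`, then `D(z) < z - z³/27 ≤ 2` on an initial
interval of positive `z`, and `D` has come down again by its end, so such a maximum exists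
(`coeff_bound`). Continuity covers the boundary of the simplex, and three equal weights attain the
bound. -/

/-! ### Real-rooted polynomials -/

theorem splits_of_complex_roots_real {p : ℝ[X]}
    (h : ∀ z : ℂ, aeval z p = 0 → z.im = 0) : p.Splits := by
  refine Splits.of_splits_map (algebraMap ℝ ℂ) (IsAlgClosed.splits _) fun z hz => ?_
  have hz' : aeval z p = 0 := by
    rw [← eval_map_algebraMap]
    exact (mem_roots'.1 hz).2
  exact ⟨z.re, Complex.ext (by simp) (by simp [h z hz'])⟩

/-- The polynomial with constant term `1` whose reciprocal roots are the negatives of `s`. -/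
noncomputable def recipProd (s : Multiset ℝ) : ℝ[X] := (s.map fun a => 1 + C a * X).prod

theorem recipProd_cons (a : ℝ) (s : Multiset ℝ) :
    recipProd (a ::ₘ s) = recipProd s + C a * X * recipProd s := by
  simp [recipProd, add_mul]

theorem eval_recipProd (s : Multiset ℝ) (w : ℝ) :
    (recipProd s).eval w = (s.map fun a => 1 + a * w).prod := by
  simp [recipProd, eval_multiset_prod, Multiset.map_map]

theorem coeff_zero_recipProd (s : Multiset ℝ) : (recipProd s).coeff 0 = 1 := by
  rw [coeff_zero_eq_eval_zero, eval_recipProd]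
  simp

theorem coeff_succ_recipProd_cons (a : ℝ) (s : Multiset ℝ) (n : ℕ) :
    (recipProd (a ::ₘ s)).coeff (n + 1) =
      (recipProd s).coeff (n + 1) + a * (recipProd s).coeff n := by
  rw [recipProd_cons, coeff_add, mul_assoc, coeff_C_mul, coeff_X_mul]

theorem coeff_recipProd_nonneg {s : Multiset ℝ} (hs : ∀ a ∈ s, 0 ≤ a) (n : ℕ) :
    0 ≤ (recipProd s).coeff n := by
  induction s using Multiset.induction_on generalizing n with
  | empty => simp [recipProd, coeff_one]; split_ifs <;> norm_num
  | cons a s ih =>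
    have ih := ih fun b hb => hs b (Multiset.mem_cons_of_mem hb)
    cases n with
    | zero => rw [coeff_zero_recipProd]; norm_num
    | succ n =>
      rw [coeff_succ_recipProd_cons]
      exact add_nonneg (ih _) (mul_nonneg (hs a (Multiset.mem_cons_self a s)) (ih _))

/-- Each factor is `X - r = -r (1 - r⁻¹ X)`; the constant term fixes the remaining scalar. -/
theorem eq_recipProd_of_splits {H : ℝ[X]} (hH : H.Splits) (h0 : H.coeff 0 = 1) :
    H = recipProd (H.roots.map fun r => -r⁻¹) := by
  have hne : ∀ r ∈ H.roots, r ≠ 0 := by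
    rintro r hr rfl
    have := (mem_roots'.1 hr).2
    rw [IsRoot, ← coeff_zero_eq_eval_zero, h0] at this
    exact one_ne_zero this
  have key : ∀ s : Multiset ℝ, (∀ r ∈ s, r ≠ 0) →
      (s.map fun r => X - C r).prod =
        C ((s.map fun r => -r).prod) * recipProd (s.map fun r => -r⁻¹) := by
    intro s
    induction s using Multiset.induction_on with
    | empty => simp [recipProd]
    | cons a s ih =>
      intro hs
      have ha := hs a (Multiset.mem_cons_self a s)
      have h1 : (C a : ℝ[X]) * C a⁻¹ = 1 := by rw [← C_mul, mul_inv_cancel₀ ha, C_1]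
      simp only [Multiset.map_cons, Multiset.prod_cons, recipProd_cons, C_mul, C_neg,
        ih fun b hb => hs b (Multiset.mem_cons_of_mem hb)]
      linear_combination (-X * C (Multiset.map (fun r => -r) s).prod *
        recipProd (Multiset.map (fun r => -r⁻¹) s)) * h1
  have h1 := hH.eq_prod_roots
  rw [key _ hne, ← mul_assoc, ← C_mul] at h1
  have h2 : H.leadingCoeff * (H.roots.map fun r => -r).prod = 1 := by
    have := congrArg (fun p => p.coeff 0) h1
    simp only [coeff_C_mul, coeff_zero_recipProd, h0, mul_one] at this
    exact this.symm
  rw [h2, C_1, one_mul] at h1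
  exact h1

/-- Bonferroni inequalities for `∏ (1 - a w)`. -/
theorem eval_neg_recipProd_bounds {s : Multiset ℝ} {w : ℝ} (hw : 0 ≤ w)
    (hs : ∀ a ∈ s, 0 ≤ a ∧ a * w ≤ 1) :
    (0 ≤ (recipProd s).eval (-w) ∧ (recipProd s).eval (-w) ≤ 1) ∧
    1 - (recipProd s).coeff 1 * w ≤ (recipProd s).eval (-w) ∧
    (recipProd s).eval (-w) ≤ 1 - (recipProd s).coeff 1 * w + (recipProd s).coeff 2 * w ^ 2 := by
  induction s using Multiset.induction_on with
  | empty => simp [recipProd, coeff_one]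
  | cons a s ih =>
    obtain ⟨⟨h0, h1⟩, h2, h3⟩ := ih fun b hb => hs b (Multiset.mem_cons_of_mem hb)
    obtain ⟨ha, haw⟩ := hs a (Multiset.mem_cons_self a s)
    have haw0 := mul_nonneg ha hw
    have e : (recipProd (a ::ₘ s)).eval (-w) = (1 - a * w) * (recipProd s).eval (-w) := by
      rw [recipProd_cons]; simp; ring
    rw [e, coeff_succ_recipProd_cons, coeff_succ_recipProd_cons, coeff_zero_recipProd]
    refine ⟨⟨mul_nonneg (by linarith) h0, ?_⟩, ?_, ?_⟩
    · nlinarith [mul_nonneg haw0 h0]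
    · nlinarith [mul_nonneg haw0 (sub_nonneg.2 h1)]
    · nlinarith [mul_nonneg haw0 (sub_nonneg.2 h2)]

/-- Bernoulli's inequality, factor by factor: `1 - a w ≤ (1 - a w / 4) ^ 4`. It serves to compare `z
H(-z²)` at `√w` and `√w / 2`. -/
theorem eval_neg_recipProd_quarter {s : Multiset ℝ} {w : ℝ}
    (hs : ∀ a ∈ s, 0 ≤ a * w ∧ a * w ≤ 1) :
    0 ≤ (recipProd s).eval (-w) ∧ 0 < (recipProd s).eval (-(w / 4)) ∧
    (recipProd s).eval (-w) ≤ (recipProd s).eval (-(w / 4)) ^ 4 := by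
  induction s using Multiset.induction_on with
  | empty => simp [recipProd]
  | cons a s ih =>
    obtain ⟨h0, h1, h2⟩ := ih fun b hb => hs b (Multiset.mem_cons_of_mem hb)
    obtain ⟨ha0, ha1⟩ := hs a (Multiset.mem_cons_self a s)
    have e : ∀ v : ℝ, (recipProd (a ::ₘ s)).eval (-v) = (1 - a * v) * (recipProd s).eval (-v) := by
      intro v
      rw [recipProd_cons]; simp; ring
    rw [e, e, mul_pow]
    refine ⟨mul_nonneg (by linarith) h0, mul_pos (by linarith) h1, ?_⟩
    refine mul_le_mul ?_ h2 h0 (by positivity)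
    have := one_add_mul_le_pow (a := -(a * (w / 4))) (by linarith) 4
    calc 1 - a * w = 1 + (4 : ℕ) * -(a * (w / 4)) := by push_cast; ring
      _ ≤ _ := this
      _ = _ := by ring

/-- Off its roots, a nonconstant real-rooted polynomial is strictly log-concave in absolute value. -/
theorem exists_eval_mul_eval_lt {q : ℝ[X]} (hq : q.Splits) (hdeg : q.natDegree ≠ 0) {z d : ℝ}
    (hz : q.eval z ≠ 0) (hd : 0 < d) :
    ∃ h, 0 < h ∧ h < d ∧ q.eval (z + h) * q.eval (z - h) < q.eval z ^ 2 := by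
  have hne : ∀ r ∈ q.roots, z - r ≠ 0 := by
    intro r hr h0
    rw [sub_eq_zero] at h0
    exact hz (h0 ▸ (mem_roots'.1 hr).2)
  have hsmall : ∀ s : Multiset ℝ, (∀ r ∈ s, z - r ≠ 0) →
      ∃ h, 0 < h ∧ h < d ∧ ∀ r ∈ s, h < |z - r| := by
    intro s
    induction s using Multiset.induction_on with
    | empty => exact fun _ => ⟨d / 2, by linarith, by linarith, by simp⟩
    | cons a s ih =>
      intro hs
      obtain ⟨h, h1, h2, h3⟩ := ih fun b hb => hs b (Multiset.mem_cons_of_mem hb)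
      have ha := abs_pos.2 (hs a (Multiset.mem_cons_self a s))
      refine ⟨min h (|z - a| / 2), lt_min h1 (by linarith), (min_le_left _ _).trans_lt h2, ?_⟩
      intro r hr
      rcases Multiset.mem_cons.1 hr with rfl | hr
      · exact (min_le_right _ _).trans_lt (by linarith)
      · exact (min_le_left _ _).trans_lt (h3 r hr)
  obtain ⟨h, h1, h2, h3⟩ := hsmall _ hne
  refine ⟨h, h1, h2, ?_⟩
  have key : ∀ s : Multiset ℝ, (∀ r ∈ s, h < |z - r|) →
      0 ≤ (s.map fun r => z + h - r).prod * (s.map fun r => z - h - r).prod ∧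
      0 < (s.map fun r => z - r).prod ^ 2 ∧
      (s.map fun r => z + h - r).prod * (s.map fun r => z - h - r).prod
        ≤ (s.map fun r => z - r).prod ^ 2 ∧
      (s ≠ 0 → (s.map fun r => z + h - r).prod * (s.map fun r => z - h - r).prod
        < (s.map fun r => z - r).prod ^ 2) := by
    intro s
    induction s using Multiset.induction_on with
    | empty => simp
    | cons a s ih =>
      intro hs
      obtain ⟨i0, i1, i2, -⟩ := ih fun b hb => hs b (Multiset.mem_cons_of_mem hb)
      have ha := hs a (Multiset.mem_cons_self a s)
      have hsq : h ^ 2 < (z - a) ^ 2 := by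
        rw [← sq_abs (z - a)]
        exact pow_lt_pow_left₀ ha h1.le two_ne_zero
      simp only [Multiset.map_cons, Multiset.prod_cons]
      -- Paired factors give `(z - a)² - h²`, which is positive because `h` is below the distance
      -- from `z` to every root.
      have e : ∀ A B : ℝ, (z + h - a) * A * ((z - h - a) * B) = ((z - a) ^ 2 - h ^ 2) * (A * B) := by
        intros; ring
      have hlt : ((z - a) ^ 2 - h ^ 2) * ((s.map fun r => z + h - r).prod *
          (s.map fun r => z - h - r).prod) < (z - a) ^ 2 * (s.map fun r => z - r).prod ^ 2 := by
        refine (mul_le_mul_of_nonneg_left i2 (by linarith)).trans_lt ?_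
        exact mul_lt_mul_of_pos_right (by nlinarith) i1
      rw [e, mul_pow]
      refine ⟨mul_nonneg (by linarith) i0, mul_pos ?_ i1, hlt.le, fun _ => hlt⟩
      linarith [sq_nonneg h]
  have hroots : q.roots ≠ 0 := hq.roots_ne_zero hdeg
  have hlc : 0 < q.leadingCoeff ^ 2 := by
    have : q.leadingCoeff ≠ 0 := leadingCoeff_ne_zero.2 fun h => hz (by simp [h])
    positivity
  rw [hq.eval_eq_prod_roots, hq.eval_eq_prod_roots, hq.eval_eq_prod_roots]
  have := mul_lt_mul_of_pos_left ((key _ h3).2.2.2 hroots) hlc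
  calc _ = _ := by ring
    _ < _ := this
    _ = _ := by ring

/-- A nonconstant real-rooted polynomial has no negative local maximum. -/
theorem not_negative_local_max {q : ℝ[X]} (hq : q.Splits) (hdeg : q.natDegree ≠ 0) {z d : ℝ}
    (hd : 0 < d) (hz : q.eval z < 0) : ∃ y, |y - z| < d ∧ q.eval z < q.eval y := by
  by_contra! hc
  obtain ⟨h, h1, h2, h3⟩ := exists_eval_mul_eval_lt hq hdeg hz.ne hd
  have a1 := hc (z + h) (by rw [add_sub_cancel_left, abs_of_pos h1]; exact h2)
  have a2 := hc (z - h) (by rw [sub_sub_cancel_left, abs_neg, abs_of_pos h1]; exact h2)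
  -- Two values at most `q(z) < 0` have product at least `q(z)²`.
  nlinarith

/-! ### The coefficient bound -/

/-- If `H` has only nonpositive real roots and `z H(-z²) - 2` only real ones, then `z H(-z²)` has
a local maximum of height at least `2`, which bounds the first two coefficients of `H`. -/
theorem coeff_bound {H : ℝ[X]} (h0 : H.coeff 0 = 1)
    (hroot : ∀ w : ℂ, aeval w H = 0 → w.im = 0 ∧ w.re ≤ 0)
    (htwo : ∀ z : ℂ, z * aeval (-z ^ 2) H = 2 → z.im = 0) :
    H.coeff 1 - 24 * H.coeff 2 ≤ 1 / 27 := by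
  by_contra! hlt
  have hsp : H.Splits := splits_of_complex_roots_real fun z hz => (hroot z hz).1
  obtain ⟨s, hs, rfl⟩ : ∃ s : Multiset ℝ, (∀ a ∈ s, 0 ≤ a) ∧ H = recipProd s := by
    refine ⟨_, ?_, eq_recipProd_of_splits hsp h0⟩
    intro a ha
    obtain ⟨r, hr, rfl⟩ := Multiset.mem_map.1 ha
    have : aeval (r : ℂ) H = 0 := by
      have h := (mem_roots'.1 hr).2
      rw [IsRoot] at h
      have h' := aeval_algebraMap_apply ℂ r H
      rw [coe_aeval_eq_eval, h, map_zero] at h'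
      exact h'
    have := (hroot _ this).2
    rw [Complex.ofReal_re] at this
    exact neg_nonneg.2 (inv_nonpos.2 this)
  set e₁ := (recipProd s).coeff 1 with he₁
  set e₂ := (recipProd s).coeff 2 with he₂
  have he₂0 : 0 ≤ e₂ := coeff_recipProd_nonneg hs 2
  -- Take `w` as the smaller of `24` and the first zero `1 / max a` of `H(-w)`. At `24` the
  -- Bonferroni bound gives less than `1 - 24/27 = 1/9`.
  obtain ⟨w, hw0, hw24, hws, hw9⟩ : ∃ w : ℝ, 0 < w ∧ w ≤ 24 ∧ (∀ a ∈ s, a * w ≤ 1) ∧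
      (recipProd s).eval (-w) < 1 / 9 := by
    by_cases h : ∀ a ∈ s, a * 24 ≤ 1
    · refine ⟨24, by norm_num, le_rfl, h, ?_⟩
      have := (eval_neg_recipProd_bounds (w := 24) (by norm_num)
        fun a ha => ⟨hs a ha, h a ha⟩).2.2
      rw [← he₁, ← he₂] at this
      linarith
    · push Not at h
      obtain ⟨b, hb, hb1⟩ := h
      obtain ⟨a, ha, hmax⟩ := s.toFinset.exists_max_image id ⟨b, Multiset.mem_toFinset.2 hb⟩
      have hba : b ≤ a := hmax b (Multiset.mem_toFinset.2 hb)
      have ha0 : 1 / 24 < a := by linarith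
      have ha0' : 0 < a := by linarith
      refine ⟨a⁻¹, by positivity, ?_, ?_, ?_⟩
      · rw [inv_le_comm₀ ha0' (by norm_num)]; linarith
      · intro c hc
        have : c ≤ a := hmax c (Multiset.mem_toFinset.2 hc)
        rw [← div_eq_mul_inv, div_le_one ha0']
        exact this
      · have : (recipProd s).eval (-a⁻¹) = 0 := by
          rw [eval_recipProd]
          refine Multiset.prod_eq_zero (Multiset.mem_map.2 ⟨a, Multiset.mem_toFinset.1 ha, ?_⟩)
          field_simp
          ring
        rw [this]; norm_num
  set D : ℝ[X] := X * (recipProd s).comp (-X ^ 2) with hD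
  have hDe : ∀ z : ℝ, D.eval z = z * (recipProd s).eval (-z ^ 2) := by intro z; simp [hD]
  set r := √w with hr
  have hr0 : 0 < r := Real.sqrt_pos.2 hw0
  have hr2 : r ^ 2 = w := Real.sq_sqrt hw0.le
  have hDlt : ∀ z ∈ Set.Icc 0 r, D.eval z < 2 := by
    rintro z ⟨hz0, hzr⟩
    rcases hz0.eq_or_lt with rfl | hz0
    · rw [hDe]; norm_num
    have hzw : z ^ 2 ≤ w := hr2 ▸ pow_le_pow_left₀ hz0.le hzr 2
    have := (eval_neg_recipProd_bounds (w := z ^ 2) (by positivity) fun a ha =>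
      ⟨hs a ha, (mul_le_mul_of_nonneg_left hzw (hs a ha)).trans (hws a ha)⟩).2.2
    rw [← he₁, ← he₂] at this
    rw [hDe]
    -- Since `z² ≤ 24`, the quadratic term is absorbed into the linear one; this is where the factor
    -- `24` enters.
    have h1 : e₂ * (z ^ 2) ^ 2 ≤ e₂ * (24 * z ^ 2) :=
      mul_le_mul_of_nonneg_left (by nlinarith [sq_nonneg z]) he₂0
    have h2 : (1 / 27 : ℝ) * z ^ 2 < (e₁ - 24 * e₂) * z ^ 2 :=
      mul_lt_mul_of_pos_right hlt (by positivity)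
    have h3 : (recipProd s).eval (-z ^ 2) < 1 - 1 / 27 * z ^ 2 := by linarith
    have h4 := mul_lt_mul_of_pos_left h3 hz0
    -- `54 - 27 z + z³ = (z - 3)² (z + 6)`.
    nlinarith [mul_nonneg (sq_nonneg (z - 3)) (by linarith : 0 ≤ z + 6)]
  have hhalf : D.eval r < D.eval (r / 2) ∧ 0 < D.eval (r / 2) := by
    obtain ⟨q0, q1, q2⟩ := eval_neg_recipProd_quarter (s := s) (w := w) fun a ha =>
      ⟨mul_nonneg (hs a ha) hw0.le, hws a ha⟩
    rw [hDe, hDe, hr2, div_pow, hr2, show (2 : ℝ) ^ 2 = 4 by norm_num]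
    set P := (recipProd s).eval (-w)
    set Q := (recipProd s).eval (-(w / 4))
    refine ⟨?_, by positivity⟩
    -- Otherwise `Q ≤ 2 P < 2/9`, while `Q / 2 ≤ P ≤ Q ^ 4` forces `Q ^ 3 ≥ 1/2`.
    have : P < Q / 2 := by
      by_contra! hPQ
      have hQ : Q < 2 / 9 := by linarith
      have hQ3 : Q ^ 3 < (2 / 9) ^ 3 := pow_lt_pow_left₀ hQ q1.le (by norm_num)
      have : Q * (1 / 2) ≤ Q * Q ^ 3 := by nlinarith
      have := le_of_mul_le_mul_left this q1
      norm_num at hQ3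
      linarith
    have := mul_lt_mul_of_pos_left this hr0
    linarith
  obtain ⟨z, hzI, hzmax⟩ := isCompact_Icc.exists_isMaxOn
    (Set.nonempty_Icc.2 hr0.le) (D.continuous.continuousOn (s := Set.Icc 0 r))
  have hzmax : ∀ y ∈ Set.Icc 0 r, D.eval y ≤ D.eval z := fun y hy => hzmax hy
  have hzhalf := hzmax (r / 2) ⟨by linarith, by linarith⟩
  have hz0 : 0 < z := hzI.1.lt_of_ne fun h => by
    have : D.eval z = 0 := by rw [← h, hDe, zero_mul]
    linarith [hhalf.2]
  have hzr : z < r := hzI.2.lt_of_ne fun h => by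
    rw [h] at hzhalf; linarith [hhalf.1]
  have hqe : ∀ y, (D - C 2).eval y = D.eval y - 2 := by intro y; simp
  have hqs : (D - C 2).Splits := splits_of_complex_roots_real fun y hy => htwo y (by
    simp only [hD, map_sub, map_mul, aeval_X, aeval_comp, map_neg, map_pow, aeval_C] at hy
    simpa using sub_eq_zero.1 hy)
  have hqd : (D - C 2).natDegree ≠ 0 := by
    intro h
    obtain ⟨c, hc⟩ := natDegree_eq_zero.1 h
    have h1 := hqe r
    have h2 := hqe (r / 2)
    rw [← hc, eval_C] at h1 h2
    linarith [hhalf.1]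
  obtain ⟨y, hy, hlt'⟩ := not_negative_local_max hqs hqd (d := min z (r - z))
    (lt_min hz0 (by linarith)) (z := z) (by rw [hqe]; linarith [hDlt z hzI])
  rw [hqe, hqe] at hlt'
  have hy1 := abs_lt.1 (hy.trans_le (min_le_left _ _))
  have hy2 := abs_lt.1 (hy.trans_le (min_le_right _ _))
  linarith [hzmax y ⟨by linarith, by linarith⟩]

/-! ### Transfer matrices and the energy argument -/

/-- The product of the transfer matrices `!![x i * t, 1; 1, 0]` for `i < n`, latest on the left. -/
def transfer {R : Type*} [CommRing R] (x : ℕ → R) (t : R) : ℕ → Matrix (Fin 2) (Fin 2) R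
  | 0 => 1
  | n + 1 => !![x n * t, 1; 1, 0] * transfer x t n

section Transfer

variable {R : Type*} [CommRing R] (x : ℕ → R) (t : R)

theorem transfer_succ (n : ℕ) :
    transfer x t (n + 1) = !![x n * t, 1; 1, 0] * transfer x t n := rfl

theorem transfer_succ_zero (n : ℕ) (j : Fin 2) :
    transfer x t (n + 1) 0 j = x n * t * transfer x t n 0 j + transfer x t n 1 j := by
  simp [transfer_succ, Matrix.mul_apply, Fin.sum_univ_two]

theorem transfer_succ_one (n : ℕ) (j : Fin 2) :
    transfer x t (n + 1) 1 j = transfer x t n 0 j := by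
  simp [transfer_succ, Matrix.mul_apply, Fin.sum_univ_two]

theorem det_transfer (n : ℕ) : (transfer x t n).det = (-1) ^ n := by
  induction n with
  | zero => simp [transfer]
  | succ n ih => rw [transfer_succ, Matrix.det_mul, ih, Matrix.det_fin_two_of]; ring

theorem map_transfer {S : Type*} [CommRing S] (φ : R →+* S) (n : ℕ) (i j : Fin 2) :
    φ (transfer x t n i j) = transfer (fun k => φ (x k)) (φ t) n i j := by
  induction n generalizing i with
  | zero => fin_cases i <;> fin_cases j <;> simp [transfer]
  | succ n ih =>
    fin_cases i
    · simp [transfer_succ_zero, ih]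
    · simp [transfer_succ_one, ih]

end Transfer

/-- An eigenvalue of modulus one of a transfer matrix with positive weights forces `t` to be
purely imaginary. -/
theorem re_eq_zero_of_transfer_mulVec {x : ℕ → ℝ} {t lam : ℂ} {K : ℕ} (hK : 2 ≤ K)
    (hx : ∀ i < K, 0 < x i) (hlam : ‖lam‖ = 1) {v : Fin 2 → ℂ} (hv : v ≠ 0)
    (h : (transfer (fun i => (x i : ℂ)) t K).mulVec v = lam • v) : t.re = 0 := by
  by_contra ht
  set u : ℕ → Fin 2 → ℂ := fun n => (transfer (fun i => (x i : ℂ)) t n).mulVec v with hu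
  have hu0 : u 0 = v := Matrix.one_mulVec v
  have hs0 : ∀ n, u (n + 1) 0 = x n * t * u n 0 + u n 1 := fun n => by
    simp only [hu, Matrix.mulVec, dotProduct, Fin.sum_univ_two, transfer_succ_zero]; ring
  have hs1 : ∀ n, u (n + 1) 1 = u n 0 := fun n => by
    simp only [hu, Matrix.mulVec, dotProduct, Fin.sum_univ_two, transfer_succ_one]
  -- Up to the factor `t.re`, `E` is the real part of the Hermitian product of the two components.
  -- Each step adds a nonnegative multiple of `|u n 0|²`, yet `|lam| = 1` makes `E` return to its
  -- initial value, so every increment vanishes.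
  set E : ℕ → ℝ := fun n => t.re * ((u n 0).re * (u n 1).re + (u n 0).im * (u n 1).im) with hE
  have hstep : ∀ n, E (n + 1) = E n + t.re ^ 2 * x n * ((u n 0).re ^ 2 + (u n 0).im ^ 2) := by
    intro n
    simp only [hE, hs0, hs1, Complex.add_re, Complex.mul_re, Complex.ofReal_re, Complex.ofReal_im,
      Complex.mul_im, Complex.add_im]
    ring
  have hmono : ∀ n, 2 ≤ n → n ≤ K → E 2 ≤ E n := by
    intro n hn
    induction n, hn using Nat.le_induction with
    | base => exact fun _ => le_rfl
    | succ n hn ih =>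
      intro hnK
      rw [hstep n]
      have := hx n (by omega)
      have : 0 ≤ t.re ^ 2 * x n * ((u n 0).re ^ 2 + (u n 0).im ^ 2) := by positivity
      linarith [ih (by omega)]
  have hend : E K = E 0 := by
    have hl : lam.re ^ 2 + lam.im ^ 2 = 1 := by
      have := Complex.sq_norm lam
      rw [hlam, Complex.normSq_apply] at this
      linarith
    have hK' : u K = lam • u 0 := by rw [hu0]; exact h
    simp only [hE, hK', Pi.smul_apply, smul_eq_mul, Complex.mul_re, Complex.mul_im]
    linear_combination (t.re * ((u 0 0).re * (u 0 1).re + (u 0 0).im * (u 0 1).im)) * hl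
  have h2 := hmono K hK le_rfl
  rw [hend, hstep, hstep] at h2
  have p0 := hx 0 (by omega)
  have p1 := hx 1 (by omega)
  have ht2 : 0 < t.re ^ 2 := by positivity
  have q0 : 0 ≤ t.re ^ 2 * x 0 * ((u 0 0).re ^ 2 + (u 0 0).im ^ 2) := by positivity
  have q1 : 0 ≤ t.re ^ 2 * x 1 * ((u 1 0).re ^ 2 + (u 1 0).im ^ 2) := by positivity
  have zero_of : ∀ (y : ℝ) (a : ℂ), 0 < y → t.re ^ 2 * y * (a.re ^ 2 + a.im ^ 2) = 0 → a = 0 := by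
    intro y a hy ha
    have := (mul_eq_zero.1 ha).resolve_left (by positivity)
    rw [← Complex.normSq_eq_zero, Complex.normSq_apply]
    linarith
  have z0 := zero_of _ _ p0 (by linarith : t.re ^ 2 * x 0 * ((u 0 0).re ^ 2 + (u 0 0).im ^ 2) = 0)
  have z1 := zero_of _ _ p1 (by linarith : t.re ^ 2 * x 1 * ((u 1 0).re ^ 2 + (u 1 0).im ^ 2) = 0)
  have z1' : u 0 1 = 0 := by
    have := hs0 0
    rw [z0, zero_add] at this
    rw [← z1, this]; ring
  apply hv
  rw [← hu0]
  ext i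
  fin_cases i
  · exact z0
  · exact z1'

/-- For odd `K` the determinant is `-1`, so the hypothesis on `lam` is the characteristic equation.
-/
theorem re_eq_zero_of_transfer_trace {x : ℕ → ℝ} {t lam : ℂ} {K : ℕ} (hK : 2 ≤ K) (hodd : Odd K)
    (hx : ∀ i < K, 0 < x i) (hlam : ‖lam‖ = 1)
    (h : lam ^ 2 - lam * (transfer (fun i => (x i : ℂ)) t K).trace - 1 = 0) : t.re = 0 := by
  set M := transfer (fun i => (x i : ℂ)) t K with hM
  have hdet : M.det = -1 := by rw [hM, det_transfer, hodd.neg_one_pow]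
  have : (M - lam • (1 : Matrix (Fin 2) (Fin 2) ℂ)).det = 0 := by
    rw [Matrix.det_fin_two] at hdet ⊢
    rw [Matrix.trace_fin_two] at h
    simp
    linear_combination h + hdet
  obtain ⟨v, hv, hv0⟩ := Matrix.exists_mulVec_eq_zero_iff.2 this
  refine re_eq_zero_of_transfer_mulVec hK hx hlam hv ?_
  rw [Matrix.sub_mulVec, Matrix.smul_mulVec, Matrix.one_mulVec] at hv0
  exact sub_eq_zero.1 hv0

/-! ### Coefficients of the trace as chain sums -/

/-- The trace of the transfer matrix, as a polynomial in the spectral parameter. -/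
noncomputable def discr (x : ℕ → ℝ) (K : ℕ) : ℝ[X] :=
  (transfer (fun i => (C (x i) : ℝ[X])) X K).trace

theorem aeval_discr (x : ℕ → ℝ) (K : ℕ) (t : ℂ) :
    aeval t (discr x K) = (transfer (fun i => (x i : ℂ)) t K).trace := by
  have h := fun i j => map_transfer (fun i => (C (x i) : ℝ[X])) X (aeval t : ℝ[X] →ₐ[ℝ] ℂ).toRingHom
    K i j
  simp only [AlgHom.toRingHom_eq_coe, RingHom.coe_coe, aeval_X, aeval_C] at h
  rw [discr, Matrix.trace_fin_two, Matrix.trace_fin_two, map_add, h, h]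
  rfl

/-- Chain sums: `chain x k n` sums `x j₁ ⋯ x jₖ` over `j₁ < ⋯ < jₖ < n` with all consecutive
differences (including `n - jₖ`) odd. -/
def chain (x : ℕ → ℝ) : ℕ → ℕ → ℝ
  | 0, _ => 1
  | k + 1, n => ∑ j ∈ Finset.range n, if Odd (n - j) then x j * chain x k j else 0

theorem chain_succ (x : ℕ → ℝ) (k n : ℕ) :
    chain x (k + 1) n = ∑ j ∈ Finset.range n, if Odd (n - j) then x j * chain x k j else 0 := rfl

theorem chain_add_two (x : ℕ → ℝ) (k n : ℕ) :
    chain x (k + 1) (n + 2) = x (n + 1) * chain x k (n + 1) + chain x (k + 1) n := by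
  rw [chain_succ, chain_succ, Finset.sum_range_succ, Finset.sum_range_succ]
  have h1 : n + 2 - (n + 1) = 1 := by omega
  have h2 : n + 2 - n = 2 := by omega
  rw [h1, h2, if_pos odd_one, if_neg (by decide), add_zero, add_comm]
  congr 1
  refine Finset.sum_congr rfl fun j hj => ?_
  have hj := Finset.mem_range.1 hj
  have : Odd (n + 2 - j) ↔ Odd (n - j) := by
    rw [show n + 2 - j = n - j + 2 by omega]
    simp [Nat.odd_add]
  simp only [this]

/-- Sums over chains with arbitrary parity of the last gap. -/
theorem sum_mul_chain (x : ℕ → ℝ) (k n : ℕ) :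
    ∑ j ∈ Finset.range (n + 1), x j * chain x k j =
      chain x (k + 1) (n + 1) + chain x (k + 1) n := by
  have : chain x (k + 1) n =
      ∑ j ∈ Finset.range (n + 1), if Odd (n + 1 - j) then 0 else x j * chain x k j := by
    rw [chain_succ, Finset.sum_range_succ]
    simp only [Nat.add_sub_cancel_left, odd_one, if_true, add_zero]
    refine Finset.sum_congr rfl fun j hj => ?_
    have hj := Finset.mem_range.1 hj
    have : Odd (n + 1 - j) ↔ ¬ Odd (n - j) := by
      rw [show n + 1 - j = n - j + 1 by omega, Nat.odd_add_one]
    by_cases h : Odd (n - j) <;> simp [this, h]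
  rw [this, chain_succ, ← Finset.sum_add_distrib]
  refine Finset.sum_congr rfl fun j _ => ?_
  split_ifs <;> simp

/-- Both sides satisfy the recurrence `chain_add_two`. No information is lost in adding the two
entries: their coefficients live in opposite parities. -/
theorem coeff_transfer_row (x : ℕ → ℝ) (k n : ℕ) :
    (transfer (fun i => (C (x i) : ℝ[X])) X n 0 0 +
      transfer (fun i => (C (x i) : ℝ[X])) X n 0 1).coeff k = chain x k n := by
  induction n using Nat.twoStepInduction generalizing k with
  | zero =>
    cases k with
    | zero => simp [transfer, chain]
    | succ k => simp [transfer, chain, coeff_one]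
  | one =>
    cases k with
    | zero => simp [transfer, chain]
    | succ k =>
      cases k with
      | zero => simp [transfer, chain, coeff_one]
      | succ k => simp [transfer, chain, coeff_one]
  | more n ih1 ih2 =>
    have e : transfer (fun i => (C (x i) : ℝ[X])) X (n + 2) 0 0 +
        transfer (fun i => (C (x i) : ℝ[X])) X (n + 2) 0 1 =
        C (x (n + 1)) * (X * (transfer (fun i => (C (x i) : ℝ[X])) X (n + 1) 0 0 +
          transfer (fun i => (C (x i) : ℝ[X])) X (n + 1) 0 1)) +
        (transfer (fun i => (C (x i) : ℝ[X])) X n 0 0 +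
          transfer (fun i => (C (x i) : ℝ[X])) X n 0 1) := by
      rw [transfer_succ_zero, transfer_succ_zero _ _ (n + 1), transfer_succ_one,
        transfer_succ_one]
      ring
    rw [e, coeff_add, ih1, coeff_C_mul]
    cases k with
    | zero => simp [chain]
    | succ k => rw [coeff_X_mul, ih2, chain_add_two]

theorem coeff_transfer_eq_zero (x : ℕ → ℝ) (n k : ℕ) :
    (Odd (n + k) → (transfer (fun i => (C (x i) : ℝ[X])) X n 0 0).coeff k = 0) ∧
    (Even (n + k) → (transfer (fun i => (C (x i) : ℝ[X])) X n 0 1).coeff k = 0) ∧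
    (Even (n + k) → (transfer (fun i => (C (x i) : ℝ[X])) X n 1 0).coeff k = 0) ∧
    (Odd (n + k) → (transfer (fun i => (C (x i) : ℝ[X])) X n 1 1).coeff k = 0) := by
  induction n generalizing k with
  | zero =>
    cases k with
    | zero => simp [transfer]
    | succ k => simp [transfer, coeff_one]
  | succ n ih =>
    have hp : n + 1 + k = n + k + 1 := by ring
    simp only [transfer_succ_zero, transfer_succ_one, coeff_add, mul_assoc, coeff_C_mul, hp,
      Nat.odd_add_one, Nat.even_add_one, Nat.not_odd_iff_even, Nat.not_even_iff_odd]
    obtain ⟨a, b, c, d⟩ := ih k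
    refine ⟨fun h => ?_, fun h => ?_, fun h => a h, fun h => b h⟩
    · rw [c h]
      cases k with
      | zero => simp
      | succ k =>
        rw [coeff_X_mul, (ih k).1 (by rw [← add_assoc, Nat.even_add_one] at h; simpa using h)]
        simp
    · rw [d h]
      cases k with
      | zero => simp
      | succ k =>
        rw [coeff_X_mul, (ih k).2.1 (by rw [← add_assoc, Nat.odd_add_one] at h; simpa using h)]
        simp

theorem coeff_discr_even (x : ℕ → ℝ) {K k : ℕ} (hK : Odd K) (hk : Even k) :
    (discr x K).coeff k = 0 := by
  have h : Odd (K + k) := hK.add_even hk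
  rw [discr, Matrix.trace_fin_two, coeff_add, (coeff_transfer_eq_zero x K k).1 h,
    (coeff_transfer_eq_zero x K k).2.2.2 h, add_zero]

theorem coeff_discr_odd (x : ℕ → ℝ) {K k : ℕ} (hK : Odd K) (hk : Even k) :
    (discr x K).coeff (k + 1) = ∑ j ∈ Finset.range K, x j * chain x k j := by
  obtain ⟨n, rfl⟩ : ∃ n, K = n + 1 := ⟨K - 1, by have := hK.pos; omega⟩
  have h : Even (n + 1 + (k + 1)) := hK.add_odd hk.add_one
  have h' := coeff_transfer_eq_zero x (n + 1) (k + 1)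
  -- The lower right entry at `n + 1` is the upper right entry at `n`; parity kills the other two
  -- terms of the row sums.
  rw [sum_mul_chain, ← coeff_transfer_row, ← coeff_transfer_row, discr, Matrix.trace_fin_two,
    coeff_add, coeff_add, coeff_add, h'.2.1 h, transfer_succ_one]
  have := h'.2.2.1 h
  rw [transfer_succ_one] at this
  rw [this]
  ring

/-- The discriminant is odd: it is `X * H(X²)`. -/
theorem exists_discr_eq (x : ℕ → ℝ) {K : ℕ} (hK : Odd K) :
    ∃ H : ℝ[X], (∀ j, H.coeff j = (discr x K).coeff (2 * j + 1)) ∧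
      discr x K = X * expand ℝ 2 H := by
  refine ⟨contract 2 (divX (discr x K)), fun j => ?_, ?_⟩
  · rw [coeff_contract two_ne_zero, coeff_divX, mul_comm]
  · ext k
    cases k with
    | zero => simpa using coeff_discr_even x hK Even.zero
    | succ k =>
      rw [coeff_X_mul, coeff_expand two_pos]
      split_ifs with h
      · rw [coeff_contract two_ne_zero, coeff_divX, Nat.div_mul_cancel h]
      · exact coeff_discr_even x hK (Nat.even_add_one.2 (mt even_iff_two_dvd.1 h))

theorem chain_sum_bound {x : ℕ → ℝ} {K : ℕ} (hK : 2 ≤ K) (hodd : Odd K)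
    (hx : ∀ i < K, 0 < x i) (hsum : ∑ j ∈ Finset.range K, x j = 1) :
    ∑ j ∈ Finset.range K, x j * chain x 2 j - 24 * ∑ j ∈ Finset.range K, x j * chain x 4 j
      ≤ 1 / 27 := by
  obtain ⟨H, hc, hH⟩ := exists_discr_eq x hodd
  have hev : ∀ t : ℂ, (transfer (fun i => (x i : ℂ)) t K).trace = t * aeval (t ^ 2) H := by
    intro t
    rw [← aeval_discr, hH, map_mul, aeval_X, expand_aeval]
  have h1 := hc 1
  have h2 := hc 2
  rw [coeff_discr_odd x hodd (by decide)] at h1 h2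
  rw [← h1, ← h2]
  refine coeff_bound ?_ ?_ ?_
  · rw [hc, coeff_discr_odd x hodd (by decide)]
    simpa [chain] using hsum
  · intro w hw
    obtain ⟨t, rfl⟩ : ∃ t : ℂ, t ^ 2 = w := IsAlgClosed.exists_pow_nat_eq w two_pos
    have ht : t.re = 0 := by
      refine re_eq_zero_of_transfer_trace (lam := 1) hK hodd hx (by simp) ?_
      rw [hev, hw]; ring
    simp [pow_two, ht]
    exact mul_self_nonneg _
  · intro z hz
    have ht : (Complex.I * z).re = 0 := by
      -- At `t = I z` the trace is `I z H(-z²) = 2 I`, so `I` is a double eigenvalue.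
      refine re_eq_zero_of_transfer_trace (lam := Complex.I) hK hodd hx (by simp) ?_
      rw [hev, mul_pow, Complex.I_sq, neg_one_mul]
      linear_combination (-Complex.I ^ 2) * hz - 2 * Complex.I_sq
    simpa using ht

/-! ### The multi-index sums as chain sums -/

theorem chain_succ_fin {K : ℕ} (y : ℕ → ℝ) (k : ℕ) (i : Fin K) :
    chain y (k + 1) i =
      ∑ j : Fin K, (if j < i ∧ Odd ((i : ℕ) - j) then 1 else 0) * (y j * chain y k j) := by
  simp only [chain_succ, Fin.lt_def]
  rw [Fin.sum_univ_eq_sum_range (fun j : ℕ =>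
    (if j < (i : ℕ) ∧ Odd ((i : ℕ) - j) then 1 else 0) * (y j * chain y k j)) K]
  have hsub : Finset.range i ⊆ Finset.range K := Finset.range_subset_range.2 i.2.le
  rw [← Finset.sum_subset hsub (fun j _ hj => ?_)]
  · refine Finset.sum_congr rfl fun j hj => ?_
    simp [Finset.mem_range.1 hj]
  · rw [Finset.mem_range] at hj
    simp [hj]

theorem f₃_eq_sum_chain (K : ℕ) (y : ℕ → ℝ) :
    f₃ K (fun i => y i) = ∑ j ∈ Finset.range K, y j * chain y 2 j := by
  rw [← Fin.sum_univ_eq_sum_range (fun j => y j * chain y 2 j) K, f₃, triples, Finset.sum_filter]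
  -- Chains unfold from the largest index down, so the triple is reversed.
  let e : Fin K × Fin K × Fin K ≃ Fin K × Fin K × Fin K :=
    ⟨fun (a, b, c) => (c, b, a), fun (a, b, c) => (c, b, a), fun _ => rfl, fun _ => rfl⟩
  rw [← e.sum_comp]
  simp only [Fintype.sum_prod_type, chain_succ_fin, Finset.mul_sum]
  refine Finset.sum_congr rfl fun a _ => Finset.sum_congr rfl fun b _ =>
    Finset.sum_congr rfl fun c _ => ?_
  simp only [e, Equiv.coe_fn_mk, chain]
  by_cases h₁ : b < a ∧ Odd ((a : ℕ) - b)
  · by_cases h₂ : c < b ∧ Odd ((b : ℕ) - c)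
    · rw [if_pos ⟨⟨h₂.1, h₁.1⟩, h₂.2, h₁.2⟩, if_pos h₁, if_pos h₂]; ring
    · rw [if_neg (fun q => h₂ ⟨q.1.1, q.2.1⟩), if_neg h₂]; ring
  · rw [if_neg (fun q => h₁ ⟨q.1.2, q.2.2⟩), if_neg h₁]; ring

theorem f₅_eq_sum_chain (K : ℕ) (y : ℕ → ℝ) :
    f₅ K (fun i => y i) = ∑ j ∈ Finset.range K, y j * chain y 4 j := by
  rw [← Fin.sum_univ_eq_sum_range (fun j => y j * chain y 4 j) K, f₅, quintuples,
    Finset.sum_filter]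
  let e : Fin K × Fin K × Fin K × Fin K × Fin K ≃ Fin K × Fin K × Fin K × Fin K × Fin K :=
    ⟨fun (a, b, c, d, e) => (e, d, c, b, a), fun (a, b, c, d, e) => (e, d, c, b, a),
      fun _ => rfl, fun _ => rfl⟩
  rw [← e.sum_comp]
  simp only [Fintype.sum_prod_type, chain_succ_fin, Finset.mul_sum]
  refine Finset.sum_congr rfl fun a _ => Finset.sum_congr rfl fun b _ =>
    Finset.sum_congr rfl fun c _ => Finset.sum_congr rfl fun d _ =>
    Finset.sum_congr rfl fun i _ => ?_
  simp only [e, Equiv.coe_fn_mk, chain]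
  by_cases h₁ : b < a ∧ Odd ((a : ℕ) - b)
  · by_cases h₂ : c < b ∧ Odd ((b : ℕ) - c)
    · by_cases h₃ : d < c ∧ Odd ((c : ℕ) - d)
      · by_cases h₄ : i < d ∧ Odd ((d : ℕ) - i)
        · rw [if_pos ⟨⟨h₄.1, h₃.1, h₂.1, h₁.1⟩, h₄.2, h₃.2, h₂.2, h₁.2⟩, if_pos h₁, if_pos h₂,
            if_pos h₃, if_pos h₄]
          ring
        · rw [if_neg (fun q => h₄ ⟨q.1.1, q.2.1⟩), if_neg h₄]; ring
      · rw [if_neg (fun q => h₃ ⟨q.1.2.1, q.2.2.1⟩), if_neg h₃]; ring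
    · rw [if_neg (fun q => h₂ ⟨q.1.2.2.1, q.2.2.2.1⟩), if_neg h₂]; ring
  · rw [if_neg (fun q => h₁ ⟨q.1.2.2.2, q.2.2.2.2⟩), if_neg h₁]; ring

/-! ### The bound on the simplex and its attainment -/

theorem f_le_of_pos {K : ℕ} (hK : 2 ≤ K) (hodd : Odd K) {x : Fin K → ℝ} (hx : ∀ i, 0 < x i)
    (hsum : ∑ i, x i = 1) : f K x ≤ 1 / 27 := by
  set y : ℕ → ℝ := fun n => if h : n < K then x ⟨n, h⟩ else 0 with hy
  have hxy : x = fun i : Fin K => y i := by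
    ext i; simp [hy]
  rw [f, hxy, f₃_eq_sum_chain, f₅_eq_sum_chain]
  refine chain_sum_bound hK hodd (fun i hi => ?_) ?_
  · simp only [hy, dif_pos hi]; exact hx _
  · rw [← Fin.sum_univ_eq_sum_range y K, ← hsum, hxy]

theorem continuous_f (K : ℕ) : Continuous (f K) := by
  unfold f f₃ f₅
  fun_prop

theorem f_le_of_mem_stdSimplex {K : ℕ} (hK : 2 ≤ K) (hodd : Odd K) {x : Fin K → ℝ}
    (hx : x ∈ stdSimplex ℝ (Fin K)) : f K x ≤ 1 / 27 := by
  have hK0 : (0 : ℝ) < K := by exact_mod_cast (by omega : 0 < K)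
  -- Moving towards the barycentre makes all weights positive, as the energy argument requires.
  set p : ℝ → Fin K → ℝ := fun ε i => (1 - ε) * x i + ε * (K : ℝ)⁻¹ with hp
  have hp0 : p 0 = x := by ext i; simp [hp]
  have hpc : Continuous p := by fun_prop
  have ht : Filter.Tendsto (fun ε => f K (p ε)) (nhdsWithin 0 (Set.Ioi 0)) (nhds (f K x)) := by
    have := ((continuous_f K).comp hpc).tendsto 0
    simp only [Function.comp_apply, hp0] at this
    exact this.mono_left nhdsWithin_le_nhds
  refine le_of_tendsto ht ?_
  filter_upwards [Ioo_mem_nhdsGT (zero_lt_one' ℝ)] with ε hε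
  refine f_le_of_pos hK hodd (fun i => ?_) ?_
  · have h1 := mul_nonneg (sub_nonneg.2 hε.2.le) (hx.1 i)
    have h2 := mul_pos hε.1 (inv_pos.2 hK0)
    simp only [hp]
    linarith
  · simp only [hp, Finset.sum_add_distrib, ← Finset.mul_sum, hx.2, Finset.sum_const,
      Finset.card_univ, Fintype.card_fin, nsmul_eq_mul]
    field_simp
    ring

/-- The maximizer: uniform on the first three coordinates. -/
noncomputable def uniformThree (K : ℕ) (i : Fin K) : ℝ := if (i : ℕ) < 3 then 1 / 3 else 0

theorem uniformThree_mem_stdSimplex {K : ℕ} (hK : 3 ≤ K) :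
    uniformThree K ∈ stdSimplex ℝ (Fin K) := by
  refine ⟨fun i => ?_, ?_⟩
  · unfold uniformThree; split_ifs <;> norm_num
  · unfold uniformThree
    rw [Fin.sum_univ_eq_sum_range (fun i => if i < 3 then (1 / 3 : ℝ) else 0) K]
    have hsub : Finset.range 3 ⊆ Finset.range K := Finset.range_subset_range.2 hK
    rw [← Finset.sum_subset hsub fun j _ hj => if_neg fun h => hj (Finset.mem_range.2 h)]
    norm_num [Finset.sum_range_succ]

theorem f_uniformThree {K : ℕ} (hK : 3 ≤ K) : f K (uniformThree K) = 1 / 27 := by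
  have h5 : f₅ K (uniformThree K) = 0 := by
    refine Finset.sum_eq_zero ?_
    rintro ⟨a, b, c, d, e⟩ h
    simp only [quintuples, Finset.mem_filter, Finset.mem_univ, true_and, Fin.lt_def] at h
    -- Five increasing indices end at `4` or beyond.
    have : uniformThree K e = 0 := if_neg (by omega)
    rw [this, mul_zero]
  have h3 : f₃ K (uniformThree K) = 1 / 27 := by
    have h0 : 0 < K := by omega
    have h1 : 1 < K := by omega
    have h2 : 2 < K := by omega
    rw [f₃, Finset.sum_eq_single (⟨⟨0, h0⟩, ⟨1, h1⟩, ⟨2, h2⟩⟩ : Fin K × Fin K × Fin K)]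
    · norm_num [uniformThree]
    · rintro ⟨a, b, c⟩ h hne
      simp only [triples, Finset.mem_filter, Finset.mem_univ, true_and, Fin.lt_def] at h
      have : ¬ (c : ℕ) < 3 := fun hc => hne (by
        simp only [Prod.mk.injEq, Fin.ext_iff]; omega)
      have : uniformThree K c = 0 := if_neg this
      rw [this, mul_zero]
    · intro h
      exact absurd (by simp [triples]) h
  rw [f, h3, h5]; norm_num

end Herman

theorem mainTheorem3 (K : ℕ) (hK : 3 ≤ K) (hodd : Odd K) :
    IsGreatest (Herman.f K '' stdSimplex ℝ (Fin K)) (1 / 27) := by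
  refine ⟨⟨_, Herman.uniformThree_mem_stdSimplex hK, Herman.f_uniformThree hK⟩, ?_⟩
  rintro _ ⟨x, hx, rfl⟩
  exact Herman.f_le_of_mem_stdSimplex (by omega) hodd hx
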